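/- Let $S$ be a set of $n$ points in the Euclidean plane in convex position (the vertex set of a convex $n$-gon). Let $d_1>d_2>\dotsb$ be the distinct distances between pairs of points of $S$, and let $m_i$ be the number of unordered pairs of points of $S$ at distance $d_i$ from one another ($m_i=0$ if there are fewer than $i$ distances). Then, for all sufficiently large $n$, every such $S$ satisfies $$m_2\le \tfrac43\,n .$$ More precisely, call a real number $C$ admissible for $(k,\ell)$ if every set of $n$ points in convex position (for any $n$) that contains two distinct vertices $a,b$ with $|ab|\ge d_k$ and with at most $\ell$ vertices strictly between $a$ and $b$ on one of the two boundary arcs joining them satisfies $m_1+\dotsb+m_k\le n+C$. Then an admissible constant for $(k,\ell)=(2,16)$ exists, and for every such constant $C=C(2,16)$, the inequality $m_2\le\frac43 n$ holds for every set of $n$ points in convex position with $n\ge 3\,C(2,16)$. -/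

import Mathlib

/-- The Euclidean plane. -/
abbrev Plane : Type := EuclideanSpace ℝ (Fin 2)

/-- A finite point set is in convex position (it is the vertex set of a convex polygon) if no point
of it lies in the convex hull of the others. -/
def InConvexPosition (S : Finset Plane) : Prop :=
  ConvexIndependent ℝ (fun x : S => (x : Plane))

open scoped Classical in
/-- The set of all distances between two distinct points of `S`. -/
noncomputable def distances (S : Finset Plane) : Finset ℝ :=
  S.offDiag.image (fun p => dist p.1 p.2)

open scoped Classical in
/-- `IsNthDistance S i r`: the number `r` is the `i`-th largest distance `d_i` of `S`
(`i = 1, 2, …`), that is, `r` is a distance of `S` and exactly `i - 1` distances of `S` exceed it. -/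
def IsNthDistance (S : Finset Plane) (i : ℕ) (r : ℝ) : Prop :=
  r ∈ distances S ∧ ((distances S).filter (fun s => r < s)).card + 1 = i

open scoped Classical in
/-- `distMultiplicity S i` is `m_i`: the number of unordered pairs of points of `S` at distance `d_i`
from one another (it is `0` if `S` has fewer than `i` distances). -/
noncomputable def distMultiplicity (S : Finset Plane) (i : ℕ) : ℕ :=
  ((S.offDiag.filter (fun p => IsNthDistance S i (dist p.1 p.2))).image
    (fun p => s(p.1, p.2))).card

/-- The number of top-`k` distances, `m_1 + ⋯ + m_k`. -/
noncomputable def topMultiplicity (S : Finset Plane) (k : ℕ) : ℕ :=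
  ∑ i ∈ Finset.Icc 1 k, distMultiplicity S i

/-- Twice the signed area of the triangle `a b x`; it is positive iff `x` lies strictly to the left
of the line from `a` to `b`. -/
def orient (a b x : Plane) : ℝ :=
  (b 0 - a 0) * (x 1 - a 1) - (b 1 - a 1) * (x 0 - a 0)

open scoped Classical in
/-- The vertices strictly between `a` and `b` on the boundary of the convex polygon with vertex set
`S`, when one walks clockwise from `a` to `b`: those strictly to the left of the line from `a` to
`b`. The vertices on the other boundary arc are `verticesBetween S b a`. -/
noncomputable def verticesBetween (S : Finset Plane) (a b : Plane) : Finset Plane :=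
  S.filter (fun x => 0 < orient a b x)

/-- Some diagonal (or side) `ab` of `S` has length at least `d_k` and at most `l` vertices between
its endpoints, on one of the two boundary arcs (the pair `a`, `b` is ordered, so both arcs are
allowed). -/
def HasSpecialDiagonal (S : Finset Plane) (k l : ℕ) : Prop :=
  ∃ a ∈ S, ∃ b ∈ S, a ≠ b ∧ (∃ r, IsNthDistance S k r ∧ r ≤ dist a b) ∧
    (verticesBetween S a b).card ≤ l

/-- `C` is an admissible value of the constant `C(k, l)`: every set of `n` points in convex position
having a diagonal of length at least `d_k` with at most `l` vertices between its endpoints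
satisfies `m_1 + ⋯ + m_k ≤ n + C`. -/
def IsSpecialDiagonalConstant (k l : ℕ) (C : ℝ) : Prop :=
  ∀ S : Finset Plane, InConvexPosition S → HasSpecialDiagonal S k l →
    (topMultiplicity S k : ℝ) ≤ (S.card : ℝ) + C

/-- The indices `i`, `j`, `k` are distinct and occur in this cyclic order. -/
def Cyc {n : ℕ} (i j k : Fin n) : Prop :=
  (i.val < j.val ∧ j.val < k.val) ∨ (j.val < k.val ∧ k.val < i.val) ∨
    (k.val < i.val ∧ i.val < j.val)

/-- The indices `i`, `j`, `k`, `l` are distinct and occur in this cyclic order. -/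
def Quad {n : ℕ} (i j k l : Fin n) : Prop :=
  Cyc i j k ∧ Cyc i k l

/-- The combinatorial properties of the largest distance (`A`) and the second largest distance (`B`)
among the vertices, in cyclic order, of a convex polygon. -/
structure DistanceSystem {n : ℕ} (A B : Fin n → Fin n → Prop) : Prop where
  symmA : ∀ {i j}, A i j → A j i
  symmB : ∀ {i j}, B i j → B j i
  disj : ∀ {i j}, A i j → B i j → False
  irreflB : ∀ {i}, ¬ B i i
  AA : ∀ {i j k l}, Quad i j k l → A i j → A k l → False
  AB : ∀ {i j k l}, Quad i j k l → A i j → B k l → A i k ∧ A j l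
  BB : ∀ {i j k l}, Quad i j k l → B i j → B k l → A i k ∨ A j l
  hex : ∀ {p r x s q y}, Quad p r x s → Quad p s q y → B r y → B p y → B p q → B r s → B x s →
    B x q → False

/-- The pair `p q` can be rotated at either endpoint, in the same direction, to `p y` and `q x`. -/
def IsSource {n : ℕ} (B : Fin n → Fin n → Prop) (p q x y : Fin n) : Prop :=
  Quad p x q y ∧ B p q ∧ B p y ∧ B q x

/-- The pair `x y` arises by rotating both endpoints of some pair. -/
def IsTarget {n : ℕ} (B : Fin n → Fin n → Prop) (x y : Fin n) : Prop :=
  ∃ p q, IsSource B p q x y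

namespace DistanceSystem

variable {n : ℕ} {A B : Fin n → Fin n → Prop}

theorem isSource_swap (h : DistanceSystem A B) {p q x y : Fin n} (s : IsSource B p q x y) :
    IsSource B q p y x := by
  obtain ⟨hq, h1, h2, h3⟩ := s
  refine ⟨?_, h.symmB h1, h3, h2⟩
  simp only [Quad, Cyc] at *
  omega

theorem isTarget_symm (h : DistanceSystem A B) {x y : Fin n} (t : IsTarget B x y) :
    IsTarget B y x := by
  obtain ⟨p, q, s⟩ := t
  exact ⟨q, p, h.isSource_swap s⟩

theorem isTarget_A (h : DistanceSystem A B) {x y : Fin n} (t : IsTarget B x y) : A x y := by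
  obtain ⟨p, q, hq, h1, h2, h3⟩ := t
  have : Quad y p x q := by simp only [Quad, Cyc] at *; omega
  rcases h.BB this (h.symmB h2) (h.symmB h3) with h4 | h4
  · exact h.symmA h4
  · exact (h.disj h4 h1).elim

theorem isSource_unique_of_lt (h : DistanceSystem A B) {p q r s x y : Fin n}
    (s1 : IsSource B p q x y) (s2 : IsSource B r s x y) (hpr : Cyc p r x) : False := by
  obtain ⟨hq, h1, h2, h3⟩ := s1
  obtain ⟨hq', h1', h2', h3'⟩ := s2
  by_cases hqs : q = s
  · subst hqs
    have e : Quad p r q y := by simp only [Quad, Cyc] at *; omega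
    have e' : Quad y p r q := by simp only [Quad, Cyc] at *; omega
    rcases h.BB e' (h.symmB h2) h1' with h4 | h4
    · exact h.disj (h.symmA h4) h2'
    · exact h.disj h4 h1
  by_cases hs : Cyc p q s
  · have e : Quad y p r s := by simp only [Quad, Cyc, Fin.ext_iff] at *; omega
    rcases h.BB e (h.symmB h2) h1' with h4 | h4
    · exact h.disj (h.symmA h4) h2'
    · have e' : Quad s p x q := by simp only [Quad, Cyc, Fin.ext_iff] at *; omega
      exact h.disj (h.AB e' (h.symmA h4) (h.symmB h3)).2 h1
  · have e : Quad q p r s := by simp only [Quad, Cyc, Fin.ext_iff] at *; omega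
    rcases h.BB e (h.symmB h1) h1' with h4 | h4
    · have e' : Quad q r x s := by simp only [Quad, Cyc, Fin.ext_iff] at *; omega
      exact h.disj (h.AB e' h4 (h.symmB h3')).2 h1'
    · refine h.hex (p := p) (r := r) (x := x) (s := s) (q := q) (y := y) ?_ ?_ h2' h2 h1 h1'
        (h.symmB h3') (h.symmB h3) <;> (simp only [Quad, Cyc, Fin.ext_iff] at *; omega)

theorem isSource_unique_left (h : DistanceSystem A B) {p q r s x y : Fin n}
    (s1 : IsSource B p q x y) (s2 : IsSource B r s x y) : p = r := by
  by_contra hne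
  by_cases hc : Cyc p r x
  · exact h.isSource_unique_of_lt s1 s2 hc
  · refine h.isSource_unique_of_lt s2 s1 ?_
    have h1 := s1.1
    have h2 := s2.1
    simp only [Quad, Cyc, Fin.ext_iff] at *
    omega

theorem isSource_unique (h : DistanceSystem A B) {p q r s x y : Fin n}
    (s1 : IsSource B p q x y) (s2 : IsSource B r s x y) : p = r ∧ q = s :=
  ⟨h.isSource_unique_left s1 s2,
    h.isSource_unique_left (h.isSource_swap s1) (h.isSource_swap s2)⟩

theorem not_A_of_isTarget (h : DistanceSystem A B) {x y w : Fin n} (t : IsTarget B x y)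
    (hw : Cyc y w x) : ¬ A w y := by
  intro ha
  obtain ⟨p, q, hq, h1, h2, h3⟩ := t
  have e : Quad y w x q := by simp only [Quad, Cyc] at *; omega
  have h4 := (h.AB e (h.symmA ha) (h.symmB h3)).2
  by_cases hpw : p = w
  · subst hpw
    exact h.disj h4 h1
  by_cases hc : Cyc p w x
  · have e' : Quad w q y p := by simp only [Quad, Cyc, Fin.ext_iff] at *; omega
    exact h.disj (h.AB e' h4 (h.symmB h2)).2 (h.symmB h1)
  · have e' : Quad y w p q := by simp only [Quad, Cyc, Fin.ext_iff] at *; omega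
    exact h.disj (h.AB e' (h.symmA ha) h1).1 (h.symmB h2)

theorem isTarget_ne {x y : Fin n} (t : IsTarget B x y) : x ≠ y := by
  obtain ⟨p, q, hq, -⟩ := t
  simp only [Quad, Cyc, Fin.ext_iff, ne_eq] at *
  omega

theorem isTarget_unique_left (h : DistanceSystem A B) {x x' y : Fin n} (t : IsTarget B x y)
    (t' : IsTarget B x' y) : x = x' := by
  by_contra hne
  have h1 := isTarget_ne t
  have h2 := isTarget_ne t'
  by_cases hc : Cyc y x x'
  · exact h.not_A_of_isTarget t' hc (h.isTarget_A t)
  · refine h.not_A_of_isTarget t ?_ (h.isTarget_A t')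
    simp only [Cyc, Fin.ext_iff, ne_eq] at *
    omega

theorem isTarget_unique_right (h : DistanceSystem A B) {x y y' : Fin n} (t : IsTarget B x y)
    (t' : IsTarget B x y') : y = y' :=
  h.isTarget_unique_left (h.isTarget_symm t) (h.isTarget_symm t')

theorem finRotate_val {n : ℕ} (i : Fin n) :
    (finRotate n i).val = i.val + 1 ∨ (i.val + 1 = n ∧ (finRotate n i).val = 0) := by
  obtain _ | m := n
  · exact i.elim0
  · rcases Fin.eq_castSucc_or_eq_last i with ⟨j, rfl⟩ | rfl
    · left; rw [finRotate_apply]; simp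
    · right; simp

theorem source_eq_of_shift (h : DistanceSystem A B) {a b c d p q : Fin n} (t : IsTarget B a b)
    (hcd : IsSource B p q c d) (hc : ∀ z, ¬ Cyc a z c) (hq : Quad a c b d) : p = a := by
  by_contra hne
  have hz := hc p
  have e : Quad a b d p := by
    have := hcd.1
    simp only [Quad, Cyc, Fin.ext_iff] at *
    omega
  have h1 := (h.AB e (h.isTarget_A t) (h.symmB hcd.2.2.1)).2
  refine h.not_A_of_isTarget t ?_ (h.symmA h1)
  simp only [Quad, Cyc, Fin.ext_iff] at *
  omega

theorem quad_of_cyc {n : ℕ} {a b c d c' d' : Fin n} (o1 : Cyc a c b) (o2 : Cyc b d a)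
    (o3 : Cyc b c' a) (o4 : Cyc a d' b) (hca : ¬ Cyc a d' c) (hdb : ¬ Cyc b c' d) (h1 : c' ≠ d)
    (h2 : d' ≠ c) : Quad c' c d' d := by
  have q1 : Cyc c d' b := by simp only [Cyc, Fin.ext_iff, ne_eq] at *; omega
  have q2 : Cyc d c' a := by simp only [Cyc, Fin.ext_iff, ne_eq] at *; omega
  clear hca hdb h1 h2
  simp only [Quad, Cyc] at *
  omega

theorem not_isTarget_rotate (h : DistanceSystem A B) {a b c' d' : Fin n} (t : IsTarget B a b)
    (tc : IsTarget B (finRotate n a) c') (td : IsTarget B (finRotate n b) d') : False := by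
  have ha := finRotate_val a
  have hb := finRotate_val b
  generalize finRotate n a = c at *
  generalize finRotate n b = d at *
  obtain ⟨p0, q0, hs0, -⟩ := id t
  have hca : ∀ z, ¬ Cyc a z c := by intro z; have := z.2; simp only [Cyc]; omega
  have hdb : ∀ z, ¬ Cyc b z d := by intro z; have := z.2; simp only [Cyc]; omega
  have l1 := a.2
  have l2 := b.2
  have l3 := p0.2
  have l4 := q0.2
  have o1 : Cyc a c b := by simp only [Quad, Cyc] at *; omega
  have o2 : Cyc b d a := by simp only [Quad, Cyc] at *; omega
  have hc'a : c' ≠ a := by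
    rintro rfl
    have := h.isTarget_unique_left tc (h.isTarget_symm t)
    subst this
    simp only [Cyc] at o1; omega
  have hc'b : c' ≠ b := by
    rintro rfl
    have := h.isTarget_unique_left tc t
    subst this
    simp only [Cyc] at o1; omega
  have hd'a : d' ≠ a := by
    rintro rfl
    have := h.isTarget_unique_left td (h.isTarget_symm t)
    subst this
    simp only [Cyc] at o2; omega
  have hd'b : d' ≠ b := by
    rintro rfl
    have := h.isTarget_unique_left td t
    subst this
    simp only [Cyc] at o2; omega
  have hcc := isTarget_ne tc
  have hdd := isTarget_ne td
  have o3 : Cyc b c' a := by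
    by_contra hcon
    refine h.AA (i := b) (j := a) (k := c) (l := c') ?_ (h.symmA (h.isTarget_A t))
      (h.isTarget_A tc)
    have := hca c'
    simp only [Quad, Cyc, Fin.ext_iff, ne_eq] at *
    omega
  have o4 : Cyc a d' b := by
    by_contra hcon
    refine h.AA (i := a) (j := b) (k := d) (l := d') ?_ (h.isTarget_A t) (h.isTarget_A td)
    have := hdb d'
    simp only [Quad, Cyc, Fin.ext_iff, ne_eq] at *
    omega
  have e : c' = d := by
    by_contra hne
    have hne' : d' ≠ c := by
      rintro rfl
      exact hne (h.isTarget_unique_right tc (h.isTarget_symm td))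
    exact h.AA (quad_of_cyc o1 o2 o3 o4 (hca d') (hdb c') hne hne') (h.symmA (h.isTarget_A tc))
      (h.symmA (h.isTarget_A td))
  subst e
  obtain ⟨p, q, s⟩ := tc
  have e1 := h.source_eq_of_shift t s hca (by simp only [Quad, Cyc] at *; omega)
  have e2 := h.source_eq_of_shift (h.isTarget_symm t) (h.isSource_swap s) hdb
    (by simp only [Quad, Cyc] at *; omega)
  subst e1 e2
  exact h.disj (h.isTarget_A t) s.2.1

open scoped Classical in
theorem three_mul_card_target_le (h : DistanceSystem A B) :
    3 * (Finset.univ.filter fun e : Fin n × Fin n => IsTarget B e.1 e.2).card ≤ 2 * n := by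
  set T := Finset.univ.filter fun e : Fin n × Fin n => IsTarget B e.1 e.2 with hT
  set W := T.image Prod.fst with hW
  set W1 := W.filter fun x => finRotate n x ∉ W with hW1
  have hWT : W.card = T.card := by
    refine Finset.card_image_of_injOn ?_
    rintro ⟨x, y⟩ h1 ⟨x', y'⟩ h2 (rfl : x = x')
    simp only [hT, Finset.coe_filter, Finset.mem_univ, true_and, Set.mem_ofPred_eq] at h1 h2
    rw [h.isTarget_unique_right h1 h2]
  have hmem : ∀ x, x ∈ W ↔ ∃ y, IsTarget B x y := by
    intro x; simp [hW, hT]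
  have h1 : W1.card + W.card ≤ n := by
    have : (W1.image (finRotate n)).card = W1.card :=
      Finset.card_image_of_injective _ (finRotate n).injective
    rw [← this, ← Finset.card_union_of_disjoint]
    · simpa using Finset.card_le_univ (W1.image (finRotate n) ∪ W)
    · rw [Finset.disjoint_left]
      intro x hx
      obtain ⟨y, hy, rfl⟩ := Finset.mem_image.1 hx
      exact (Finset.mem_filter.1 hy).2
  have hW1mem : ∀ x, x ∈ W1 ↔ x ∈ W ∧ finRotate n x ∉ W := fun x => Finset.mem_filter
  have h2 : T.card ≤ W1.card + W1.card := by
    have hsub : T ⊆ (T.filter fun e => e.1 ∈ W1) ∪ (T.filter fun e => e.2 ∈ W1) := by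
      rintro ⟨x, y⟩ he
      have ht : IsTarget B x y := by simpa [hT] using he
      have hx : x ∈ W := (hmem x).2 ⟨y, ht⟩
      have hy : y ∈ W := (hmem y).2 ⟨x, h.isTarget_symm ht⟩
      rw [Finset.mem_union]
      by_cases hsx : finRotate n x ∈ W
      · refine Or.inr (Finset.mem_filter.2 ⟨he, (hW1mem y).2 ⟨hy, fun hsy => ?_⟩⟩)
        obtain ⟨c', hc⟩ := (hmem _).1 hsx
        obtain ⟨d', hd⟩ := (hmem _).1 hsy
        exact h.not_isTarget_rotate ht hc hd
      · exact Or.inl (Finset.mem_filter.2 ⟨he, (hW1mem x).2 ⟨hx, hsx⟩⟩)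
    refine (Finset.card_le_card hsub).trans ((Finset.card_union_le _ _).trans ?_)
    refine Nat.add_le_add ?_ ?_
    · refine Finset.card_le_card_of_injOn Prod.fst (fun e he => (Finset.mem_filter.1 he).2) ?_
      rintro ⟨x, y⟩ h1 ⟨x', y'⟩ h2 (rfl : x = x')
      have h1' : IsTarget B x y := by simpa [hT] using (Finset.mem_filter.1 h1).1
      have h2' : IsTarget B x y' := by simpa [hT] using (Finset.mem_filter.1 h2).1
      rw [h.isTarget_unique_right h1' h2']
    · refine Finset.card_le_card_of_injOn Prod.snd (fun e he => (Finset.mem_filter.1 he).2) ?_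
      rintro ⟨x, y⟩ h1 ⟨x', y'⟩ h2 (rfl : y = y')
      have h1' : IsTarget B x y := by simpa [hT] using (Finset.mem_filter.1 h1).1
      have h2' : IsTarget B x' y := by simpa [hT] using (Finset.mem_filter.1 h2).1
      rw [h.isTarget_unique_left h1' h2']
  omega

open scoped Classical in
/-- In a convex polygon with `n` vertices at most `8 n / 3` ordered pairs of vertices are at the
second largest distance. -/
theorem three_mul_card_B_le (h : DistanceSystem A B) :
    3 * (Finset.univ.filter fun e : Fin n × Fin n => B e.1 e.2).card ≤ 8 * n := by
  set M := Finset.univ.filter fun e : Fin n × Fin n => B e.1 e.2 ∧ ∀ z, B e.1 z → ¬ Cyc e.1 e.2 z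
    with hM
  set U := Finset.univ.filter fun e : Fin n × Fin n => ∃ x y, IsSource B e.1 e.2 x y with hU
  have hMn : M.card ≤ n := by
    have : M.card ≤ (Finset.univ : Finset (Fin n)).card := by
      refine Finset.card_le_card_of_injOn Prod.fst (fun _ _ => Finset.mem_univ _) ?_
      rintro ⟨x, y⟩ h1 ⟨x', y'⟩ h2 (rfl : x = x')
      simp only [hM, Finset.coe_filter, Finset.mem_univ, true_and, Set.mem_ofPred_eq] at h1 h2
      have c1 := h1.2 _ h2.1
      have c2 := h2.2 _ h1.1
      have n1 : x ≠ y := by rintro rfl; exact h.irreflB h1.1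
      have n2 : x ≠ y' := by rintro rfl; exact h.irreflB h2.1
      have : y = y' := by
        simp only [Cyc, Fin.ext_iff, ne_eq] at *
        omega
      rw [this]
    simpa using this
  have hUT : U.card ≤ (Finset.univ.filter fun e : Fin n × Fin n => IsTarget B e.1 e.2).card := by
    have hex : ∀ e : Fin n × Fin n, ∃ f : Fin n × Fin n, e ∈ U → IsSource B e.1 e.2 f.1 f.2 := by
      intro e
      by_cases he : e ∈ U
      · obtain ⟨x, y, hs⟩ := (Finset.mem_filter.1 he).2
        exact ⟨(x, y), fun _ => hs⟩
      · exact ⟨e, fun h' => (he h').elim⟩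
    choose f hf using hex
    refine Finset.card_le_card_of_injOn f ?_ ?_
    · intro e he
      simpa using ⟨e.1, e.2, hf e he⟩
    · intro e he e' he' heq
      have s1 := hf e he
      have s2 := hf e' he'
      rw [← heq] at s2
      obtain ⟨e1, e2⟩ := h.isSource_unique s1 s2
      exact Prod.ext e1 e2
  have hsub : (Finset.univ.filter fun e : Fin n × Fin n => B e.1 e.2) ⊆
      (M ∪ M.image Prod.swap) ∪ U := by
    rintro ⟨p, q⟩ he
    have hB : B p q := by simpa using he
    by_contra hcon
    simp only [Finset.mem_union, not_or] at hcon
    obtain ⟨⟨h1, h2⟩, h3⟩ := hcon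
    have h1' : ∃ y, B p y ∧ Cyc p q y := by
      by_contra hno
      push Not at hno
      exact h1 (Finset.mem_filter.2 ⟨Finset.mem_univ _, hB, hno⟩)
    have h2' : ∃ x, B q x ∧ Cyc q p x := by
      by_contra hno
      push Not at hno
      exact h2 (Finset.mem_image.2 ⟨(q, p),
        Finset.mem_filter.2 ⟨Finset.mem_univ _, h.symmB hB, hno⟩, rfl⟩)
    obtain ⟨y, hy, oy⟩ := h1'
    obtain ⟨x, hx, ox⟩ := h2'
    refine h3 (Finset.mem_filter.2 ⟨Finset.mem_univ _, x, y, ?_, hB, hy, hx⟩)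
    simp only [Quad, Cyc] at *
    omega
  have hc := Finset.card_le_card hsub
  have hc1 := Finset.card_union_le (M ∪ M.image Prod.swap) U
  have hc2 := Finset.card_union_le M (M.image Prod.swap)
  have hc3 : (M.image Prod.swap).card ≤ M.card := Finset.card_image_le
  have hc4 := h.three_mul_card_target_le
  omega

end DistanceSystem
theorem InConvexPosition.combination_ne_zero {S : Finset Plane} (hS : InConvexPosition S)
    {p x y z : Plane} (hp : p ∈ S) (hx : x ∈ S) (hy : y ∈ S) (hz : z ∈ S) (hxp : x ≠ p)
    (hyp : y ≠ p) (hzp : z ≠ p) {u v w : ℝ} (hu : 0 ≤ u) (hv : 0 ≤ v) (hw : 0 ≤ w)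
    (hpos : 0 < u + v + w)
    (h0 : u * (x 0 - p 0) + v * (y 0 - p 0) + w * (z 0 - p 0) = 0)
    (h1 : u * (x 1 - p 1) + v * (y 1 - p 1) + w * (z 1 - p 1) = 0) : False := by
  rw [InConvexPosition, convexIndependent_iff_notMem_convexHull_sdiff] at hS
  refine hS ⟨p, hp⟩ Set.univ ?_
  have hmem : ∀ q ∈ S, q ≠ p → q ∈ (fun x : S => (x : Plane)) '' (Set.univ \ {⟨p, hp⟩}) := by
    intro q hq hqp
    exact ⟨⟨q, hq⟩, ⟨Set.mem_univ _, fun h => hqp (congrArg Subtype.val h)⟩, rfl⟩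
  refine mem_convexHull_of_exists_fintype
    (w := ![u / (u + v + w), v / (u + v + w), w / (u + v + w)]) (z := ![x, y, z]) ?_ ?_ ?_ ?_
  · intro i
    fin_cases i <;> simp <;> positivity
  · simp [Fin.sum_univ_three]
    field_simp
  · intro i
    fin_cases i
    · exact hmem x hx hxp
    · exact hmem y hy hyp
    · exact hmem z hz hzp
  · ext i
    fin_cases i <;> simp [Fin.sum_univ_three] <;> field_simp <;> linarith

theorem dist_sq_eq (x y : Plane) : dist x y ^ 2 = (x 0 - y 0) ^ 2 + (x 1 - y 1) ^ 2 := by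
  rw [EuclideanSpace.dist_eq, Real.sq_sqrt (by positivity), Fin.sum_univ_two, Real.dist_eq,
    Real.dist_eq, sq_abs, sq_abs]

theorem sq_add_sq_pos_of_ne {x y : Plane} (h : x ≠ y) :
    0 < (x 0 - y 0) ^ 2 + (x 1 - y 1) ^ 2 := by
  rw [← dist_sq_eq]
  have := dist_pos.2 h
  positivity

theorem orient_rotate (a b c : Plane) : orient b c a = orient a b c := by
  simp only [orient]; ring

theorem InConvexPosition.orient_ne_zero {S : Finset Plane} (hS : InConvexPosition S)
    {x y z : Plane} (hx : x ∈ S) (hy : y ∈ S) (hz : z ∈ S) (hxy : x ≠ y) (hyz : y ≠ z)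
    (hxz : x ≠ z) : orient x y z ≠ 0 := by
  intro h
  have hpos := sq_add_sq_pos_of_ne hxy
  set N := (x 0 - y 0) ^ 2 + (x 1 - y 1) ^ 2 with hN
  set t := (y 0 - x 0) * (z 0 - x 0) + (y 1 - x 1) * (z 1 - x 1) with ht
  have e0 : N * (z 0 - x 0) = t * (y 0 - x 0) := by
    simp only [orient] at h
    linear_combination (exp := 1) (-(y 1 - x 1)) * h
  have e1 : N * (z 1 - x 1) = t * (y 1 - x 1) := by
    simp only [orient] at h
    linear_combination (exp := 1) (y 0 - x 0) * h
  rcases lt_or_ge t 0 with h1 | h1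
  · exact hS.combination_ne_zero hx hy hz hz hxy.symm hxz.symm hxz.symm (u := -t) (v := N) (w := 0)
      (by linarith) (by linarith) le_rfl (by linarith) (by linarith) (by linarith)
  rcases le_or_gt t N with h2 | h2
  · exact hS.combination_ne_zero hz hy hx hx hyz hxz hxz (u := t) (v := N - t) (w := 0)
      h1 (by linarith) le_rfl (by linarith) (by linarith) (by linarith)
  · exact hS.combination_ne_zero hy hx hz hz hxy hyz.symm hyz.symm (u := t - N) (v := N) (w := 0)
      (by linarith) (by linarith) le_rfl (by linarith) (by linarith) (by linarith)

/-- Betweenness in the rotational order around a vertex is transitive. -/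
theorem InConvexPosition.orient_trans {S : Finset Plane} (hS : InConvexPosition S)
    {p x y z : Plane} (hp : p ∈ S) (hx : x ∈ S) (hy : y ∈ S) (hz : z ∈ S)
    (hxy : 0 < orient p x y) (hyz : 0 < orient p y z) : 0 < orient p x z := by
  by_contra hcon
  have hxp : x ≠ p := by rintro rfl; simp [orient] at hxy
  have hyp : y ≠ p := by rintro rfl; simp [orient] at hyz
  have hzp : z ≠ p := by rintro rfl; simp [orient] at hyz
  refine hS.combination_ne_zero hp hx hy hz hxp hyp hzp (u := orient p y z) (v := -orient p x z)
    (w := orient p x y) hyz.le (by linarith) hxy.le (by linarith) ?_ ?_ <;>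
  · simp only [orient]; ring

theorem InConvexPosition.orient_pos_of_fan {S : Finset Plane} (hS : InConvexPosition S)
    {p x y z : Plane} (hp : p ∈ S) (hx : x ∈ S) (hy : y ∈ S) (hz : z ∈ S)
    (hxy : 0 < orient p x y) (hyz : 0 < orient p y z) : 0 < orient x y z := by
  by_contra hcon
  have hxz := hS.orient_trans hp hx hy hz hxy hyz
  have hyp : p ≠ y := by rintro rfl; simp [orient] at hyz
  have hxny : x ≠ y := by rintro rfl; simp only [orient] at hxy; linarith
  have hzny : z ≠ y := by rintro rfl; simp only [orient] at hyz; linarith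
  have hsum : orient x y z = orient p x y + orient p y z - orient p x z := by
    simp only [orient]; ring
  refine hS.combination_ne_zero hy hx hz hp hxny hzny hyp (u := orient p y z) (v := orient p x y)
    (w := -orient x y z) hyz.le hxy.le (by linarith) (by linarith) ?_ ?_ <;>
  · simp only [orient]; ring

/-- In a convex quadrilateral the diagonals are together longer than two opposite sides. -/
theorem dist_add_dist_lt_of_convex {a b c d : Plane} (habc : 0 < orient a b c)
    (hacd : 0 < orient a c d) (habd : 0 < orient a b d) (hbcd : 0 < orient b c d) :
    dist a b + dist c d < dist a c + dist b d := by
  have hsum : orient a b c + orient a c d = orient a b d + orient b c d := by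
    simp only [orient]; ring
  set s := orient a b c + orient a c d with hs
  have hs0 : 0 < s := by linarith
  set t := orient a b d / s with ht
  set r := orient a b c / s with hr
  set o := AffineMap.lineMap a c t with ho
  have ho' : o = AffineMap.lineMap b d r := by
    ext i
    fin_cases i <;>
    · simp [ho, AffineMap.lineMap_apply, ht, hr]
      field_simp
      simp only [hs, orient]
      ring
  have ht0 : 0 < t := by positivity
  have ht1 : t < 1 := by rw [ht, div_lt_one hs0]; linarith
  have hr0 : 0 < r := by positivity
  have hr1 : r < 1 := by rw [hr, div_lt_one hs0]; linarith
  have w1 : dist a o + dist o c = dist a c :=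
    (dist_add_dist_eq_iff).2 ⟨t, ⟨ht0.le, ht1.le⟩, rfl⟩
  have w2 : dist b o + dist o d = dist b d :=
    (dist_add_dist_eq_iff).2 ⟨r, ⟨hr0.le, hr1.le⟩, ho'.symm⟩
  have t1 : dist c d ≤ dist o c + dist o d := by
    rw [dist_comm o c]; exact dist_triangle _ _ _
  have t2 : dist a b < dist a o + dist b o := by
    rw [dist_comm b o]
    refine lt_of_le_of_ne (dist_triangle _ _ _) fun heq => ?_
    obtain ⟨k, -, hk⟩ := dist_add_dist_eq_iff.1 heq.symm
    have hpos : orient a b o = r * orient a b d := by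
      rw [ho']; simp only [orient, AffineMap.lineMap_apply]; simp; ring
    have hzero : orient a b o = 0 := by
      rw [← hk]; simp only [orient, AffineMap.lineMap_apply]; simp; ring
    have : 0 < r * orient a b d := by positivity
    linarith
  linarith

/-- The inner product of `x - p` and `y - p`. -/
def dotAt (p x y : Plane) : ℝ :=
  (x 0 - p 0) * (y 0 - p 0) + (x 1 - p 1) * (y 1 - p 1)

theorem dotAt_comm (p x y : Plane) : dotAt p x y = dotAt p y x := by
  simp only [dotAt]; ring

theorem dotAt_pos_of_dist_le {p r y : Plane} (hne : r ≠ p) (h : dist r y ≤ dist p y) :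
    0 < dotAt p r y := by
  have h1 := sq_add_sq_pos_of_ne hne
  have h2 : dist r y ^ 2 ≤ dist p y ^ 2 := by gcongr
  rw [dist_sq_eq, dist_sq_eq] at h2
  simp only [dotAt]
  nlinarith

theorem dotAt_pos_of_wedge {p r x y : Plane} (hrx : 0 < orient p r x) (hxy : 0 < orient p x y)
    (hry : 0 < orient p r y) (h : 0 < dotAt p r y) : 0 < dotAt p x y := by
  have hyp : y ≠ p := by rintro rfl; simp [orient] at hxy
  have h1 := sq_add_sq_pos_of_ne hyp
  have e : dotAt p x y * orient p r y = dotAt p r y * orient p x y +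
      ((y 0 - p 0) ^ 2 + (y 1 - p 1) ^ 2) * orient p r x := by
    simp only [dotAt, orient]; ring
  have : 0 < dotAt p x y * orient p r y := by rw [e]; positivity
  exact pos_of_mul_pos_left this hry.le

theorem dotAt_pos_of_wedge' {p x y q : Plane} (hxy : 0 < orient p x y) (hyq : 0 < orient p y q)
    (hxq : 0 < orient p x q) (h : 0 < dotAt p x q) : 0 < dotAt p x y := by
  have hxp : x ≠ p := by rintro rfl; simp [orient] at hxy
  have h1 := sq_add_sq_pos_of_ne hxp
  have e : dotAt p x y * orient p x q = dotAt p x q * orient p x y +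
      ((x 0 - p 0) ^ 2 + (x 1 - p 1) ^ 2) * orient p y q := by
    simp only [dotAt, orient]; ring
  have : 0 < dotAt p x y * orient p x q := by rw [e]; positivity
  exact pos_of_mul_pos_left this hxq.le

/-- A convex quadrilateral does not have four acute angles. -/
theorem not_four_acute {a b c d : Plane} (habc : 0 < orient a b c) (hbcd : 0 < orient b c d)
    (hcda : 0 < orient c d a) (hdab : 0 < orient d a b) (ha : 0 < dotAt a b d)
    (hb : 0 < dotAt b c a) (hc : 0 < dotAt c d b) (hd : 0 < dotAt d a c) : False := by
  have hba : b ≠ a := by rintro rfl; simp [orient] at habc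
  have hN := sq_add_sq_pos_of_ne hba
  set N := (b 0 - a 0) ^ 2 + (b 1 - a 1) ^ 2 with hNdef
  obtain ⟨Xv, hXv⟩ : ∃ t, t = -dotAt b c a := ⟨_, rfl⟩
  obtain ⟨Yv, hYv⟩ : ∃ t, t = orient a b c := ⟨_, rfl⟩
  obtain ⟨Xz, hXz⟩ : ∃ t, t = -dotAt a b d := ⟨_, rfl⟩
  obtain ⟨Yz, hYz⟩ : ∃ t, t = -orient d a b := ⟨_, rfl⟩
  obtain ⟨Xw, hXw⟩ : ∃ t, t = (b 0 - a 0) * (d 0 - c 0) + (b 1 - a 1) * (d 1 - c 1) := ⟨_, rfl⟩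
  obtain ⟨Yw, hYw⟩ : ∃ t, t = (b 0 - a 0) * (d 1 - c 1) - (b 1 - a 1) * (d 0 - c 0) := ⟨_, rfl⟩
  have e1 : 0 < Xv * Yw - Yv * Xw := by
    have : Xv * Yw - Yv * Xw = N * orient b c d := by
      rw [hXv, hYv, hXw, hYw, hNdef]; simp only [dotAt, orient]; ring
    rw [this]; positivity
  have e2 : Xv * Xw + Yv * Yw < 0 := by
    have : Xv * Xw + Yv * Yw = -(N * dotAt c d b) := by
      rw [hXv, hYv, hXw, hYw, hNdef]; simp only [dotAt, orient]; ring
    rw [this, neg_lt_zero]; positivity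
  have e3 : 0 < Xw * Yz - Yw * Xz := by
    have : Xw * Yz - Yw * Xz = N * orient c d a := by
      rw [hXz, hYz, hXw, hYw, hNdef]; simp only [dotAt, orient]; ring
    rw [this]; positivity
  have e4 : Xw * Xz + Yw * Yz < 0 := by
    have : Xw * Xz + Yw * Yz = -(N * dotAt d a c) := by
      rw [hXz, hYz, hXw, hYw, hNdef]; simp only [dotAt, orient]; ring
    rw [this, neg_lt_zero]; positivity
  have s1 : Xv < 0 := by linarith
  have s2 : 0 < Yv := by linarith
  have s3 : Xz < 0 := by linarith
  have s4 : Yz < 0 := by linarith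
  rcases le_or_gt 0 Xw with h | h
  · have h1 : Yw < 0 := by
      by_contra hcon
      nlinarith [mul_nonneg_of_nonpos_of_nonpos s1.le (neg_nonpos.2 (not_lt.1 hcon)),
        mul_nonneg s2.le h]
    nlinarith [mul_pos_of_neg_of_neg h1 s3, mul_nonpos_of_nonneg_of_nonpos h s4.le]
  · have h1 : Yw < 0 := by
      by_contra hcon
      nlinarith [mul_pos_of_neg_of_neg s1 h, mul_nonneg s2.le (not_lt.1 hcon)]
    nlinarith [mul_pos_of_neg_of_neg h1 s4, mul_pos_of_neg_of_neg h s3]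

/-- The vertices of a convex polygon can be enumerated counterclockwise. -/
theorem InConvexPosition.exists_enumeration {S : Finset Plane} (hS : InConvexPosition S) {n : ℕ}
    (hn : S.card = n) :
    ∃ v : Fin n → Plane, Function.Injective v ∧ (∀ x, x ∈ S ↔ ∃ i, v i = x) ∧
      ∀ i j k, Cyc i j k → 0 < orient (v i) (v j) (v k) := by
  classical
  rcases S.eq_empty_or_nonempty with rfl | ⟨p, hp⟩
  · obtain rfl : n = 0 := by simpa using hn.symm
    exact ⟨Fin.elim0, fun i => i.elim0, fun x => by simp, fun i => i.elim0⟩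
  let r : S → S → Prop := fun x y => x ≠ y ∧ (x.1 = p ∨ (y.1 ≠ p ∧ 0 < orient p x y))
  have sto : IsStrictTotalOrder S r :=
    { irrefl := fun a h => h.1 rfl
      trichotomous := by
        rintro ⟨a, ha⟩ ⟨b, hb⟩ h1 h2
        by_contra hne
        simp only [r, ne_eq, hne, Ne.symm hne, not_false_eq_true, true_and, not_or, not_and] at h1 h2
        have hab : a ≠ b := fun e => hne (Subtype.ext e)
        have h3 := h1.2 h2.1
        have h4 := h2.2 h1.1
        have h5 := hS.orient_ne_zero hp ha hb (Ne.symm h1.1) hab (Ne.symm h2.1)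
        have h6 : orient p b a = - orient p a b := by simp only [orient]; ring
        rcases lt_or_gt_of_ne h5 with h7 | h7
        · exact h4 (by linarith)
        · exact h3 h7
      trans := by
        rintro ⟨a, ha⟩ ⟨b, hb⟩ ⟨c, hc⟩ ⟨h1, h2⟩ ⟨h3, h4⟩
        simp only [ne_eq, Subtype.mk.injEq] at h1 h2 h3 h4
        rcases h4 with rfl | ⟨h4, h5⟩
        · rcases h2 with rfl | h2
          · exact (h1 rfl).elim
          · exact (h2.1 rfl).elim
        rcases h2 with rfl | ⟨h2, h6⟩
        · exact ⟨fun e => h4 (congrArg Subtype.val e).symm, Or.inl rfl⟩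
        · have h7 := hS.orient_trans hp ha hb hc h6 h5
          refine ⟨fun e => ?_, Or.inr ⟨h4, h7⟩⟩
          obtain rfl : a = c := congrArg Subtype.val e
          simp only [orient] at h7
          linarith }
  let _ : LinearOrder S := linearOrderOfSTO r
  let e : Fin n ≃o S := monoEquivOfFin S (by simpa using hn)
  have key : ∀ i j k : Fin n, i < j → j < k → 0 < orient (e i : Plane) (e j) (e k) := by
    intro i j k hij hjk
    obtain ⟨-, h1⟩ : r (e i) (e j) := e.lt_iff_lt.2 hij
    obtain ⟨h0, h2⟩ : r (e j) (e k) := e.lt_iff_lt.2 hjk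
    obtain ⟨h0', -⟩ : r (e i) (e j) := e.lt_iff_lt.2 hij
    rcases h2 with h2 | ⟨h2, h3⟩
    · rcases h1 with h1 | h1
      · exact (h0' (Subtype.ext (h1.trans h2.symm))).elim
      · exact (h1.1 h2).elim
    rcases h1 with h1 | ⟨h1, h4⟩
    · rw [h1]; exact h3
    · exact hS.orient_pos_of_fan hp (e i).2 (e j).2 (e k).2 h4 h3
  refine ⟨fun i => e i, fun i j h => e.injective (Subtype.ext h), fun x => ⟨fun hx => ?_, ?_⟩, ?_⟩
  · exact ⟨e.symm ⟨x, hx⟩, by simp⟩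
  · rintro ⟨i, rfl⟩
    exact (e i).2
  · rintro i j k (⟨h1, h2⟩ | ⟨h1, h2⟩ | ⟨h1, h2⟩)
    · exact key i j k h1 h2
    · rw [← orient_rotate]; exact key j k i h1 h2
    · rw [← orient_rotate, ← orient_rotate]; exact key k i j h1 h2

theorem quad_iff {n : ℕ} {i j k l : Fin n} :
    Quad i j k l ↔ Cyc i j k ∧ Cyc i k l ∧ Cyc i j l ∧ Cyc j k l := by
  simp only [Quad, Cyc]
  omega

/-- The two largest distances of a convex polygon form a `DistanceSystem`. -/
theorem distanceSystem_of_enumeration {n : ℕ} {v : Fin n → Plane}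
    (ho : ∀ i j k, Cyc i j k → 0 < orient (v i) (v j) (v k)) {d r : ℝ} (hr : 0 < r) (hrd : r < d)
    (htop : ∀ i j, i ≠ j → dist (v i) (v j) ≤ r ∨ dist (v i) (v j) = d) :
    DistanceSystem (fun i j => dist (v i) (v j) = d) (fun i j => dist (v i) (v j) = r) := by
  have key : ∀ {i j k l}, Quad i j k l → dist (v i) (v j) + dist (v k) (v l) <
      dist (v i) (v k) + dist (v j) (v l) := by
    intro i j k l hq
    obtain ⟨h1, h2, h3, h4⟩ := quad_iff.1 hq
    exact dist_add_dist_lt_of_convex (ho _ _ _ h1) (ho _ _ _ h2) (ho _ _ _ h3) (ho _ _ _ h4)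
  have ne : ∀ {i j k l : Fin n}, Quad i j k l → i ≠ k ∧ j ≠ l := by
    intro i j k l hq
    simp only [Quad, Cyc, ne_eq, Fin.ext_iff] at *
    omega
  refine
    { symmA := fun h => by rwa [dist_comm]
      symmB := fun h => by rwa [dist_comm]
      disj := fun h1 h2 => hrd.ne (h2.symm.trans h1)
      irreflB := fun {i} h => by rw [dist_self] at h; exact hr.ne h
      AA := ?_, AB := ?_, BB := ?_, hex := ?_ }
  · intro i j k l hq h1 h2
    have := key hq
    rcases htop _ _ (ne hq).1 with h3 | h3 <;> rcases htop _ _ (ne hq).2 with h4 | h4 <;> linarith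
  · intro i j k l hq h1 h2
    have := key hq
    rcases htop _ _ (ne hq).1 with h3 | h3 <;> rcases htop _ _ (ne hq).2 with h4 | h4
    · linarith
    · linarith
    · linarith
    · exact ⟨h3, h4⟩
  · intro i j k l hq h1 h2
    have := key hq
    rcases htop _ _ (ne hq).1 with h3 | h3
    · rcases htop _ _ (ne hq).2 with h4 | h4
      · linarith
      · exact Or.inr h4
    · exact Or.inl h3
  · intro p r x s q y hq1 hq2 h1 h2 h3 h4 h5 h6
    have o : ∀ {i j k}, Cyc i j k → 0 < orient (v i) (v j) (v k) := fun h => ho _ _ _ h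
    have nrp : v r ≠ v p := by
      intro e
      have := o hq1.1
      simp only [e, orient] at this
      linarith
    have nqs : v q ≠ v s := by
      intro e
      have := o hq2.1
      simp only [e, orient] at this
      linarith
    have nrx : v r ≠ v x := by
      intro e
      have := o hq1.1
      simp only [e, orient] at this
      linarith
    have nqy : v q ≠ v y := by
      intro e
      have := o hq2.2
      simp only [e, orient] at this
      linarith
    have c : Cyc p r x ∧ Cyc p x y ∧ Cyc p r y ∧ Cyc x s p ∧ Cyc x p r ∧ Cyc x s r ∧ Cyc s q y ∧
        Cyc s y x ∧ Cyc s q x ∧ Cyc y p s ∧ Cyc y s q ∧ Cyc y p q ∧ Cyc p x s ∧ Cyc x s y := by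
      simp only [Quad, Cyc] at hq1 hq2 ⊢
      omega
    obtain ⟨c1, c2, c3, c4, c5, c6, c7, c8, c9, c10, c11, c12, c13, c14⟩ := c
    have a1 : 0 < dotAt (v p) (v x) (v y) :=
      dotAt_pos_of_wedge (o c1) (o c2) (o c3) (dotAt_pos_of_dist_le nrp (h1.trans h2.symm).le)
    have a2 : 0 < dotAt (v x) (v s) (v p) := by
      refine dotAt_pos_of_wedge' (o c4) (o c5) (o c6) ?_
      rw [dotAt_comm]
      exact dotAt_pos_of_dist_le nrx (h4.trans h5.symm).le
    have a3 : 0 < dotAt (v s) (v y) (v x) := by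
      refine dotAt_pos_of_wedge (o c7) (o c8) (o c9) (dotAt_pos_of_dist_le nqs ?_)
      rw [dist_comm (v q), dist_comm (v s), h5, h6]
    have a4 : 0 < dotAt (v y) (v p) (v s) := by
      refine dotAt_pos_of_wedge' (o c10) (o c11) (o c12) ?_
      rw [dotAt_comm]
      refine dotAt_pos_of_dist_le nqy ?_
      rw [dist_comm (v q), dist_comm (v y), h3, h2]
    refine not_four_acute (o c13) (o c14) ?_ ?_ a1 a2 a3 a4
    · rw [← orient_rotate]; exact o c10
    · rw [← orient_rotate]; exact o c2

/-- If `r` is the second largest distance of `S`, then there is a single larger distance. -/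
theorem IsNthDistance.exists_largest {S : Finset Plane} {r : ℝ} (h : IsNthDistance S 2 r) :
    ∃ d, r < d ∧ (∀ x ∈ S, ∀ y ∈ S, x ≠ y → dist x y ≤ r ∨ dist x y = d) ∧
      (∀ t, IsNthDistance S 2 t → t = r) ∧ (∀ t, IsNthDistance S 1 t → t = d) := by
  classical
  obtain ⟨hr, hc⟩ := h
  obtain ⟨d, hd⟩ := Finset.card_eq_one.1 (Nat.succ_injective hc)
  have hmem : ∀ t, t ∈ distances S → (r < t ↔ t = d) := by
    intro t ht
    have := Finset.ext_iff.1 hd t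
    simpa [ht] using this
  have hd' : d ∈ distances S ∧ r < d := by
    have := Finset.ext_iff.1 hd d
    simpa using this
  refine ⟨d, hd'.2, ?_, ?_, ?_⟩
  · intro x hx y hy hne
    rcases le_or_gt (dist x y) r with h1 | h1
    · exact Or.inl h1
    · refine Or.inr ((hmem _ ?_).1 h1)
      exact Finset.mem_image.2 ⟨(x, y), Finset.mem_offDiag.2 ⟨hx, hy, hne⟩, rfl⟩
  · rintro t ⟨ht, htc⟩
    rcases lt_trichotomy t r with h1 | h1 | h1
    · exfalso
      have h2 : ({r, d} : Finset ℝ) ⊆ (distances S).filter (fun s => t < s) := by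
        intro s hs
        rcases Finset.mem_insert.1 hs with rfl | hs
        · exact Finset.mem_filter.2 ⟨hr, h1⟩
        · rw [Finset.mem_singleton.1 hs]
          exact Finset.mem_filter.2 ⟨hd'.1, h1.trans hd'.2⟩
      have h3 := Finset.card_le_card h2
      rw [Finset.card_pair hd'.2.ne] at h3
      omega
    · exact h1
    · exfalso
      obtain rfl := (hmem t ht).1 h1
      have h2 : ((distances S).filter (fun s => t < s)).Nonempty := by
        rw [← Finset.card_pos]; omega
      obtain ⟨s, hs⟩ := h2
      obtain ⟨hs1, hs2⟩ := Finset.mem_filter.1 hs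
      exact hs2.ne' ((hmem s hs1).1 (h1.trans hs2))
  · rintro t ⟨ht, htc⟩
    have h2 : (distances S).filter (fun s => t < s) = ∅ := by
      rw [← Finset.card_eq_zero]; omega
    rcases le_or_gt t r with h1 | h1
    · have : d ∈ (distances S).filter (fun s => t < s) :=
        Finset.mem_filter.2 ⟨hd'.1, h1.trans_lt hd'.2⟩
      rw [h2] at this
      simp at this
    · exact (hmem t ht).1 h1

theorem IsNthDistance.pos {S : Finset Plane} {i : ℕ} {r : ℝ} (h : IsNthDistance S i r) :
    0 < r := by
  classical
  obtain ⟨⟨x, y⟩, hp, rfl⟩ := Finset.mem_image.1 h.1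
  exact dist_pos.2 (Finset.mem_offDiag.1 hp).2.2

theorem two_mul_card_image_sym2_le {α : Type*} [DecidableEq (Sym2 α)] (T : Finset (α × α))
    (hne : ∀ p ∈ T, p.1 ≠ p.2) (hswap : ∀ p ∈ T, p.swap ∈ T) :
    2 * (T.image fun p => s(p.1, p.2)).card ≤ T.card := by
  classical
  refine Finset.mul_card_image_le_card T 2 fun a ha => ?_
  obtain ⟨p, hp, rfl⟩ := Finset.mem_image.1 ha
  have h : ({p, p.swap} : Finset (α × α)) ⊆ T.filter fun x => s(x.1, x.2) = s(p.1, p.2) := by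
    intro x hx
    rcases Finset.mem_insert.1 hx with rfl | hx
    · exact Finset.mem_filter.2 ⟨hp, rfl⟩
    · rw [Finset.mem_singleton.1 hx]
      exact Finset.mem_filter.2 ⟨hswap p hp, Sym2.eq_swap⟩
  have h2 := Finset.card_le_card h
  rwa [Finset.card_pair] at h2
  intro e
  exact hne p hp (congrArg Prod.fst e)

/-- The second largest distance occurs at most `4 n / 3` times in a convex `n`-gon. -/
theorem InConvexPosition.three_mul_distMultiplicity_two_le {S : Finset Plane}
    (hS : InConvexPosition S) : 3 * distMultiplicity S 2 ≤ 4 * S.card := by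
  classical
  by_cases hex : ∃ r, IsNthDistance S 2 r
  · obtain ⟨r, hr⟩ := hex
    obtain ⟨d, hrd, htop, huniq, -⟩ := hr.exists_largest
    obtain ⟨v, hinj, hv, ho⟩ := hS.exists_enumeration rfl
    have hvS : ∀ i, v i ∈ S := fun i => (hv _).2 ⟨i, rfl⟩
    have hD := distanceSystem_of_enumeration ho hr.pos hrd
      fun i j hij => htop _ (hvS i) _ (hvS j) (hinj.ne hij)
    have h1 := hD.three_mul_card_B_le
    have h2 : 2 * distMultiplicity S 2 ≤
        (S.offDiag.filter (fun p => IsNthDistance S 2 (dist p.1 p.2))).card := by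
      rw [distMultiplicity]
      convert two_mul_card_image_sym2_le
        (S.offDiag.filter (fun p => IsNthDistance S 2 (dist p.1 p.2))) ?_ ?_
      · exact fun p hp => (Finset.mem_offDiag.1 (Finset.mem_filter.1 hp).1).2.2
      · rintro ⟨x, y⟩ hp
        simp only [Finset.mem_filter, Finset.mem_offDiag, Prod.swap] at hp ⊢
        rw [dist_comm]
        exact ⟨⟨hp.1.2.1, hp.1.1, hp.1.2.2.symm⟩, hp.2⟩
    have h3 : (S.offDiag.filter (fun p => IsNthDistance S 2 (dist p.1 p.2))) ⊆
        (Finset.univ.filter fun e : Fin S.card × Fin S.card => dist (v e.1) (v e.2) = r).image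
          (Prod.map v v) := by
      rintro ⟨x, y⟩ hp
      simp only [Finset.mem_filter, Finset.mem_offDiag] at hp
      obtain ⟨i, rfl⟩ := (hv x).1 hp.1.1
      obtain ⟨j, rfl⟩ := (hv y).1 hp.1.2.1
      exact Finset.mem_image.2 ⟨(i, j), Finset.mem_filter.2 ⟨Finset.mem_univ _, huniq _ hp.2⟩, rfl⟩
    have h4 := (Finset.card_le_card h3).trans Finset.card_image_le
    omega
  · have : distMultiplicity S 2 = 0 := by
      rw [distMultiplicity, Finset.card_eq_zero, Finset.image_eq_empty, Finset.filter_eq_empty_iff]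
      exact fun p _ hp => hex ⟨_, hp⟩
    omega

open scoped Classical in
theorem card_le_two_of_no_chain {n : ℕ} (a : Fin n) (X : Finset (Fin n)) (ha : a ∉ X)
    (hX : ∀ i ∈ X, ∀ j ∈ X, ∀ k ∈ X, Cyc a i j → Cyc a j k → False) : X.card ≤ 2 := by
  by_contra hcon
  obtain ⟨i, j, k, hi, hj, hk, hij, hik, hjk⟩ := Finset.two_lt_card_iff.1 (not_le.1 hcon)
  have ni : a ≠ i := fun e => ha (e ▸ hi)
  have nj : a ≠ j := fun e => ha (e ▸ hj)
  have nk : a ≠ k := fun e => ha (e ▸ hk)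
  have t : ∀ x y : Fin n, a ≠ x → a ≠ y → x ≠ y → Cyc a x y ∨ Cyc a y x := by
    intro x y h1 h2 h3
    simp only [Cyc, ne_eq, Fin.ext_iff] at *
    omega
  have tr : ∀ x y z : Fin n, Cyc a x y → Cyc a y z → Cyc a x z := by
    intro x y z h1 h2
    simp only [Cyc] at *
    omega
  have h1 := hX i hi j hj k hk
  have h2 := hX i hi k hk j hj
  have h3 := hX j hj i hi k hk
  have h4 := hX j hj k hk i hi
  have h5 := hX k hk i hi j hj
  have h6 := hX k hk j hj i hi
  have t1 := t i j ni nj hij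
  have t2 := t i k ni nk hik
  have t3 := t j k nj nk hjk
  tauto

namespace DistanceSystem

variable {n : ℕ} {A B : Fin n → Fin n → Prop}

theorem A_left_of_disjoint (h : DistanceSystem A B) {i j k l : Fin n} (hq : Quad i j k l)
    (hA : A i j) (hE : A k l ∨ B k l) : A i k ∧ A j l := by
  rcases hE with hE | hE
  · exact (h.AA hq hA hE).elim
  · exact h.AB hq hA hE

theorem A_or_of_disjoint (h : DistanceSystem A B) {i j k l : Fin n} (hq : Quad i j k l)
    (hE : A i j ∨ B i j) (hE' : A k l ∨ B k l) : A i k ∨ A j l := by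
  rcases hE with hE | hE
  · exact Or.inl (h.A_left_of_disjoint hq hE hE').1
  rcases hE' with hE' | hE'
  · have hq' : Quad k l i j := by simp only [Quad, Cyc] at *; omega
    exact Or.inl (h.symmA (h.AB hq' hE' hE).1)
  · exact h.BB hq hE hE'

open scoped Classical in
/-- If `a b` is at one of the two largest distances, then all such pairs are covered by the vertices
on one side of the line `a b` and at most four further vertices. -/
theorem exists_cover (h : DistanceSystem A B) {a b : Fin n} (hab : a ≠ b)
    (hE : A a b ∨ B a b) :
    ∃ F : Finset (Fin n), F.card ≤ (Finset.univ.filter fun i => Cyc b a i).card + 6 ∧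
      ∀ i j, i ≠ j → (A i j ∨ B i j) → i ∈ F ∨ j ∈ F := by
  set X := Finset.univ.filter fun i => A a i ∧ ∃ j, (A i j ∨ B i j) ∧ Quad a b i j with hX
  set Y := Finset.univ.filter fun j => A b j ∧ ∃ i, (A i j ∨ B i j) ∧ Quad a b i j with hY
  set L := Finset.univ.filter fun i => Cyc b a i with hL
  have hX2 : X.card ≤ 2 := by
    refine card_le_two_of_no_chain a X ?_ ?_
    · intro ha
      obtain ⟨-, -, j, -, hq⟩ := Finset.mem_filter.1 ha
      simp only [Quad, Cyc] at hq
      omega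
    · intro i1 h1 i2 h2 i3 h3 o1 o2
      obtain ⟨-, a1, -⟩ := Finset.mem_filter.1 h1
      obtain ⟨-, a2, -⟩ := Finset.mem_filter.1 h2
      obtain ⟨-, a3, j, e, hq⟩ := Finset.mem_filter.1 h3
      have q2 : Quad a i2 i3 j := by simp only [Quad, Cyc] at *; omega
      refine h.AA (i := i2) (j := j) (k := a) (l := i1) ?_ (h.A_left_of_disjoint q2 a2 e).2 a1
      clear hq
      simp only [Quad, Cyc] at *
      omega
  have hY2 : Y.card ≤ 2 := by
    refine card_le_two_of_no_chain b Y ?_ ?_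
    · intro hb
      obtain ⟨-, -, j, -, hq⟩ := Finset.mem_filter.1 hb
      simp only [Quad, Cyc] at hq
      omega
    · intro j3 h3 j2 h2 j1 h1 o1 o2
      obtain ⟨-, a1, -⟩ := Finset.mem_filter.1 h1
      obtain ⟨-, a2, -⟩ := Finset.mem_filter.1 h2
      obtain ⟨-, a3, i, e, hq⟩ := Finset.mem_filter.1 h3
      have q2 : Quad j2 b i j3 := by simp only [Quad, Cyc] at *; omega
      refine h.AA (i := i) (j := j2) (k := j1) (l := b) ?_
        (h.symmA (h.A_left_of_disjoint q2 (h.symmA a2) e).1) (h.symmA a1)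
      clear hq
      simp only [Quad, Cyc] at *
      omega
  refine ⟨(({a, b} : Finset (Fin n)) ∪ L) ∪ (X ∪ Y), ?_, ?_⟩
  · have c1 := Finset.card_union_le (({a, b} : Finset (Fin n)) ∪ L) (X ∪ Y)
    have c2 := Finset.card_union_le ({a, b} : Finset (Fin n)) L
    have c3 := Finset.card_union_le X Y
    have c4 := Finset.card_le_two (a := a) (b := b)
    omega
  · have main : ∀ i j, (A i j ∨ B i j) → Quad a b i j → i ∈ X ∨ j ∈ Y := by
      intro i j e hq
      rcases h.A_or_of_disjoint hq hE e with h1 | h1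
      · exact Or.inl (Finset.mem_filter.2 ⟨Finset.mem_univ _, h1, j, e, hq⟩)
      · exact Or.inr (Finset.mem_filter.2 ⟨Finset.mem_univ _, h1, i, e, hq⟩)
    intro i j hij e
    by_contra hcon
    simp only [Finset.mem_union, Finset.mem_insert, Finset.mem_singleton, not_or] at hcon
    obtain ⟨⟨⟨⟨ia, ib⟩, iL⟩, iX, iY⟩, ⟨⟨ja, jb⟩, jL⟩, jX, jY⟩ := hcon
    have iL' : ¬ Cyc b a i := fun hc => iL (Finset.mem_filter.2 ⟨Finset.mem_univ _, hc⟩)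
    have jL' : ¬ Cyc b a j := fun hc => jL (Finset.mem_filter.2 ⟨Finset.mem_univ _, hc⟩)
    have hq : Quad a b i j ∨ Quad a b j i := by
      clear main hX2 hY2 hX hY hL iX iY jX jY iL jL
      simp only [Quad, Cyc, ne_eq, Fin.ext_iff] at *
      omega
    rcases hq with hq | hq
    · exact (main i j e hq).elim iX jY
    · exact (main j i (e.imp h.symmA h.symmB) hq).elim jX iY

end DistanceSystem

open scoped Classical in
theorem card_filter_dist_eq_dist_eq_le {S : Finset Plane} {u u' : Plane} (hu : u ≠ u') (p q : ℝ) :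
    (S.filter fun w => dist w u = p ∧ dist w u' = q).card ≤ 2 := by
  by_contra hcon
  obtain ⟨x, y, z, hx, hy, hz, hxy, hxz, hyz⟩ := Finset.two_lt_card_iff.1 (not_le.1 hcon)
  have hx := (Finset.mem_filter.1 hx).2
  have hy := (Finset.mem_filter.1 hy).2
  have hz := (Finset.mem_filter.1 hz).2
  rcases EuclideanGeometry.eq_of_dist_eq_of_dist_eq_of_finrank_eq_two (by simp) hu hxy hx.1 hy.1
    hz.1 hx.2 hy.2 hz.2 with h | h
  · exact hxz h.symm
  · exact hyz h.symm

open scoped Classical in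
theorem card_common_neighbors_le {S : Finset Plane} {u u' : Plane} (hu : u ≠ u') (d r : ℝ) :
    (S.filter fun w => (dist w u = d ∨ dist w u = r) ∧ (dist w u' = d ∨ dist w u' = r)).card ≤
      8 := by
  have hsub : (S.filter fun w => (dist w u = d ∨ dist w u = r) ∧ (dist w u' = d ∨ dist w u' = r)) ⊆
      ((S.filter fun w => dist w u = d ∧ dist w u' = d) ∪
        (S.filter fun w => dist w u = d ∧ dist w u' = r)) ∪
      ((S.filter fun w => dist w u = r ∧ dist w u' = d) ∪
        (S.filter fun w => dist w u = r ∧ dist w u' = r)) := by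
    intro w hw
    simp only [Finset.mem_filter, Finset.mem_union] at hw ⊢
    tauto
  have h1 := card_filter_dist_eq_dist_eq_le (S := S) hu d d
  have h2 := card_filter_dist_eq_dist_eq_le (S := S) hu d r
  have h3 := card_filter_dist_eq_dist_eq_le (S := S) hu r d
  have h4 := card_filter_dist_eq_dist_eq_le (S := S) hu r r
  refine (Finset.card_le_card hsub).trans ((Finset.card_union_le _ _).trans ?_)
  refine (Nat.add_le_add (Finset.card_union_le _ _) (Finset.card_union_le _ _)).trans ?_
  omega

open scoped Classical in
/-- If two distinct elements of `F` have at most `c` common neighbours in `S`, then the number of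
related pairs in `F × S` exceeds the size of `S` by at most a constant. -/
theorem card_filter_product_le {α : Type*} (F S : Finset α) (R : α → α → Prop) (c : ℕ)
    (hc : ∀ u ∈ F, ∀ u' ∈ F, u ≠ u' → (S.filter fun w => R w u ∧ R w u').card ≤ c) :
    ((F ×ˢ S).filter fun p => R p.2 p.1).card ≤ S.card + c * F.card ^ 2 := by
  have h1 : ((F ×ˢ S).filter fun p => R p.2 p.1).card =
      ∑ w ∈ S, (F.filter fun u => R w u).card := by
    simp only [Finset.card_filter]
    rw [Finset.sum_product_right]
  have h2 : ∀ w ∈ S, (F.filter fun u => R w u).card ≤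
      1 + (F.offDiag.filter fun p => R w p.1 ∧ R w p.2).card := by
    intro w _
    have : (F.offDiag.filter fun p => R w p.1 ∧ R w p.2) = (F.filter fun u => R w u).offDiag := by
      ext p
      simp only [Finset.mem_filter, Finset.mem_offDiag]
      tauto
    rw [this, Finset.offDiag_card]
    generalize (F.filter fun u => R w u).card = k
    rcases k with _ | k
    · simp
    · have : (k + 1) * (k + 1) - (k + 1) = k * k + k := by
        rw [Nat.sub_eq_iff_eq_add (Nat.le_mul_self _)]; ring
      rw [this]
      nlinarith
  have h3 : ∑ w ∈ S, (F.offDiag.filter fun p => R w p.1 ∧ R w p.2).card =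
      ∑ p ∈ F.offDiag, (S.filter fun w => R w p.1 ∧ R w p.2).card := by
    simp only [Finset.card_filter]
    exact Finset.sum_comm
  have h4 : ∑ p ∈ F.offDiag, (S.filter fun w => R w p.1 ∧ R w p.2).card ≤ F.offDiag.card * c := by
    rw [← smul_eq_mul]
    refine Finset.sum_le_card_nsmul _ _ _ fun p hp => ?_
    obtain ⟨h5, h6, h7⟩ := Finset.mem_offDiag.1 hp
    exact hc _ h5 _ h6 h7
  have h5 : F.offDiag.card ≤ F.card ^ 2 := by
    rw [Finset.offDiag_card, sq]; exact Nat.sub_le _ _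
  calc ((F ×ˢ S).filter fun p => R p.2 p.1).card
      ≤ ∑ w ∈ S, (1 + (F.offDiag.filter fun p => R w p.1 ∧ R w p.2).card) :=
        h1.trans_le (Finset.sum_le_sum h2)
    _ ≤ S.card + F.offDiag.card * c := by
        rw [Finset.sum_add_distrib, h3]
        simpa using h4
    _ ≤ S.card + c * F.card ^ 2 := by
        rw [mul_comm c]
        exact Nat.add_le_add_left (Nat.mul_le_mul_right c h5) _

theorem topMultiplicity_two (S : Finset Plane) :
    topMultiplicity S 2 = distMultiplicity S 1 + distMultiplicity S 2 := by
  rw [topMultiplicity, show Finset.Icc 1 2 = {1, 2} from rfl]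
  exact Finset.sum_pair (by norm_num)

/-- If all pairs at one of the two largest distances meet `F`, then `m₁ + m₂` exceeds the number of
points by at most a constant depending on the size of `F`. -/
theorem topMultiplicity_two_le_of_cover {S F : Finset Plane} {d r : ℝ} (hrd : r < d)
    (h2 : ∀ t, IsNthDistance S 2 t → t = r) (h1 : ∀ t, IsNthDistance S 1 t → t = d)
    (hF : ∀ x ∈ S, ∀ y ∈ S, x ≠ y → (dist x y = d ∨ dist x y = r) → x ∈ F ∨ y ∈ F) :
    topMultiplicity S 2 ≤ S.card + 8 * F.card ^ 2 := by
  classical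
  set T := (F ×ˢ S).filter fun p => dist p.2 p.1 = d ∨ dist p.2 p.1 = r with hT
  have main : ∀ i, (∀ t, IsNthDistance S i t → t = d ∨ t = r) →
      ((S.offDiag.filter (fun p => IsNthDistance S i (dist p.1 p.2))).image
        (fun p => s(p.1, p.2))) ⊆ T.image fun p => s(p.1, p.2) := by
    intro i hi e he
    obtain ⟨⟨x, y⟩, hp, rfl⟩ := Finset.mem_image.1 he
    obtain ⟨hp, hn⟩ := Finset.mem_filter.1 hp
    obtain ⟨hx, hy, hne⟩ := Finset.mem_offDiag.1 hp
    have hd := hi _ hn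
    rcases hF x hx y hy hne hd with hxF | hyF
    · refine Finset.mem_image.2 ⟨(x, y), Finset.mem_filter.2 ⟨Finset.mem_product.2 ⟨hxF, hy⟩, ?_⟩,
        rfl⟩
      rwa [dist_comm]
    · exact Finset.mem_image.2 ⟨(y, x), Finset.mem_filter.2 ⟨Finset.mem_product.2 ⟨hyF, hx⟩, hd⟩,
        Sym2.eq_swap⟩
  have hdisj : Disjoint
      ((S.offDiag.filter (fun p => IsNthDistance S 1 (dist p.1 p.2))).image (fun p => s(p.1, p.2)))
      ((S.offDiag.filter (fun p => IsNthDistance S 2 (dist p.1 p.2))).image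
        (fun p => s(p.1, p.2))) := by
    rw [Finset.disjoint_left]
    intro e he he'
    obtain ⟨⟨x, y⟩, hp, rfl⟩ := Finset.mem_image.1 he
    obtain ⟨⟨x', y'⟩, hp', heq⟩ := Finset.mem_image.1 he'
    have e1 := h1 _ (Finset.mem_filter.1 hp).2
    have e2 := h2 _ (Finset.mem_filter.1 hp').2
    have e3 : dist x' y' = dist x y := by
      rcases Sym2.eq_iff.1 heq with ⟨ha, hb⟩ | ⟨ha, hb⟩
      · simp only at ha hb; rw [ha, hb]
      · simp only at ha hb; rw [ha, hb, dist_comm]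
    simp only at e1 e2
    linarith
  have hle : topMultiplicity S 2 ≤ (T.image fun p => s(p.1, p.2)).card := by
    rw [topMultiplicity_two, distMultiplicity, distMultiplicity]
    rw [← Finset.card_union_of_disjoint (by convert hdisj)]
    refine Finset.card_le_card (Finset.union_subset ?_ ?_)
    · convert main 1 fun t ht => Or.inl (h1 t ht)
    · convert main 2 fun t ht => Or.inr (h2 t ht)
  refine hle.trans (Finset.card_image_le.trans ?_)
  refine le_of_eq_of_le ?_ (card_filter_product_le F S (fun w u => dist w u = d ∨ dist w u = r) 8
    fun u _ u' _ hne => le_of_eq_of_le ?_ (card_common_neighbors_le (S := S) hne d r))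
  · rw [hT]; congr
  · congr

theorem isSpecialDiagonalConstant_two (l : ℕ) :
    IsSpecialDiagonalConstant 2 l ((8 * (l + 6) ^ 2 : ℕ) : ℝ) := by
  classical
  rintro S hS ⟨a, ha, b, hb, hab, ⟨r, hr, hrab⟩, hl⟩
  obtain ⟨d, hrd, htop, h2, h1⟩ := hr.exists_largest
  obtain ⟨v, hinj, hv, ho⟩ := hS.exists_enumeration rfl
  have hvS : ∀ i, v i ∈ S := fun i => (hv _).2 ⟨i, rfl⟩
  have hD := distanceSystem_of_enumeration ho hr.pos hrd
    fun i j hij => htop _ (hvS i) _ (hvS j) (hinj.ne hij)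
  obtain ⟨i, rfl⟩ := (hv a).1 ha
  obtain ⟨j, rfl⟩ := (hv b).1 hb
  have hji : dist (v j) (v i) = d ∨ dist (v j) (v i) = r := by
    rw [dist_comm]
    rcases htop _ ha _ hb hab with h | h
    · exact Or.inr (le_antisymm h hrab)
    · exact Or.inl h
  obtain ⟨F, hFc, hF⟩ := hD.exists_cover (fun e => hab (congrArg v e).symm) hji
  have hL : (Finset.univ.filter fun k => Cyc i j k).card ≤ l := by
    refine le_trans ?_ hl
    refine Finset.card_le_card_of_injOn v (fun k hk => ?_) hinj.injOn
    exact Finset.mem_filter.2 ⟨hvS k, ho _ _ _ (Finset.mem_filter.1 hk).2⟩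
  have hcov := topMultiplicity_two_le_of_cover (S := S) (F := F.image v) hrd h2 h1 (by
    intro x hx y hy hne hd
    obtain ⟨k, rfl⟩ := (hv x).1 hx
    obtain ⟨m, rfl⟩ := (hv y).1 hy
    exact (hF k m (fun e => hne (congrArg v e)) hd).imp (Finset.mem_image_of_mem v)
      (Finset.mem_image_of_mem v))
  have hcard : (F.image v).card ≤ l + 6 := Finset.card_image_le.trans (by omega)
  have : topMultiplicity S 2 ≤ S.card + 8 * (l + 6) ^ 2 := hcov.trans (by gcongr)
  exact_mod_cast this

theorem mainTheorem4 :
    (∃ N : ℕ, ∀ n : ℕ, N ≤ n → ∀ S : Finset Plane, S.card = n → InConvexPosition S →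
      (distMultiplicity S 2 : ℝ) ≤ 4 / 3 * (n : ℝ)) ∧
    (∃ C : ℝ, IsSpecialDiagonalConstant 2 16 C) ∧
    (∀ C : ℝ, IsSpecialDiagonalConstant 2 16 C →
      ∀ n : ℕ, 3 * C ≤ (n : ℝ) → ∀ S : Finset Plane, S.card = n → InConvexPosition S →
        (distMultiplicity S 2 : ℝ) ≤ 4 / 3 * (n : ℝ)) := by
  have main : ∀ n : ℕ, ∀ S : Finset Plane, S.card = n → InConvexPosition S →
      (distMultiplicity S 2 : ℝ) ≤ 4 / 3 * (n : ℝ) := by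
    rintro n S rfl hS
    have h : (3 : ℝ) * distMultiplicity S 2 ≤ 4 * S.card := by
      exact_mod_cast hS.three_mul_distMultiplicity_two_le
    linarith
  exact ⟨⟨0, fun n _ => main n⟩, ⟨_, isSpecialDiagonalConstant_two 16⟩, fun _ _ n _ => main n⟩
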